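/- Rings are associative with unit and modules are left modules unless a right module is indicated. For a ring $R$ and a module $M$, write $\mathrm{pd}\,{}_RM$ (respectively $\mathrm{pd}\,M_R$) for the projective dimension of a left (respectively right) $R$-module $M$, with $\mathrm{pd}\,0=0$. The little finitistic dimension $\mathrm{fpd}\,R$ (respectively the big finitistic dimension $\mathrm{Fpd}\,R$) is the supremum of the projective dimensions of the finitely generated (respectively all) left $R$-modules of finite projective dimension, and the global dimension $\mathrm{gd}\,R$ is the supremum of the projective dimensions of all left $R$-modules; these are elements of $\{0,1,2,\dots\}\cup\{\infty\}$. A ring is left perfect if each of its left modules has a projective cover, and semiperfect if each of its finitely generated left modules has a projective cover. Let $\Lambda$ be a ring and let $K$ be a two-sided ideal of $\Lambda$ contained in the Jacobson radical $J(\Lambda)$ such that the natural epimorphism $\pi\colon\Lambda\to\Lambda/K$ splits as a ring homomorphism, i.e. there is a unital ring homomorphism $\iota\colon\Lambda/K\to\Lambda$ with $\pi\iota=\mathrm{id}$. (1) Assume that $\Lambda$ is left artinian, that $\mathrm{pd}\,K_\Lambda<\infty$, and that $\mathrm{pd}\,{}_\Lambda K<\infty$ or $K^2=0$. Then $$\mathrm{fpd}\,\Lambda<\infty\iff\mathrm{fpd}\,\Lambda/K<\infty,$$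 and the same equivalence holds with $\mathrm{Fpd}$ and with $\mathrm{gd}$ in place of $\mathrm{fpd}$. (2) Assume that $\Lambda$ is left noetherian and semiperfect. (i) If $\mathrm{pd}\,{}_\Lambda K<\infty$, then $$\mathrm{fpd}\,\Lambda/K\le\mathrm{fpd}\,\Lambda\le\mathrm{fpd}\,\Lambda/K+\mathrm{pd}\,K_\Lambda+1.$$ (ii) If $K^2=0$, then $$\mathrm{fpd}\,\Lambda/K\le\mathrm{fpd}\,\Lambda+\mathrm{pd}\,K_\Lambda\quad\text{and}\quad\mathrm{fpd}\,\Lambda\le\mathrm{fpd}\,\Lambda/K+\mathrm{pd}\,K_\Lambda+1.$$ (3) If $\Lambda$ is left perfect, then (i) and (ii) of (2) hold with $\mathrm{Fpd}$ in place of $\mathrm{fpd}$. (4) If $\Lambda$ is left noetherian and semiperfect, or left perfect, then (i) and (ii) of (2) hold with $\mathrm{gd}$ in place of $\mathrm{fpd}$. -/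

import Mathlib

universe u

namespace FinitisticDim

/-- The projective dimension of a left `R`-module `M`, with values in `ℕ∞`
(the zero module has dimension `0`). -/
noncomputable def pd (R : Type u) [Ring R] (M : Type u) [AddCommGroup M] [Module R M] : ℕ∞ :=
  (CategoryTheory.projectiveDimension (ModuleCat.of R M)).unbotD 0

/-- The little finitistic dimension of `R`: the supremum of the projective dimensions of the
finitely generated left modules of finite projective dimension. -/
noncomputable def littleFinDim (R : Type u) [Ring R] : ℕ∞ :=
  ⨆ (M : ModuleCat.{u} R) (_ : Module.Finite R M) (_ : pd R M < ⊤), pd R M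

/-- The big finitistic dimension of `R`: the supremum of the projective dimensions of all
left modules of finite projective dimension. -/
noncomputable def bigFinDim (R : Type u) [Ring R] : ℕ∞ :=
  ⨆ (M : ModuleCat.{u} R) (_ : pd R M < ⊤), pd R M

/-- The (left) global dimension of `R`. -/
noncomputable def globalDim (R : Type u) [Ring R] : ℕ∞ :=
  ⨆ M : ModuleCat.{u} R, pd R M

/-- A projective cover: an epimorphism from a projective module with superfluous kernel. -/
structure IsProjectiveCover {R : Type u} [Ring R] {P M : Type u} [AddCommGroup P] [Module R P]
    [AddCommGroup M] [Module R M] (f : P →ₗ[R] M) : Prop where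
  projective : Module.Projective R P
  surjective : Function.Surjective f
  superfluous : ∀ N : Submodule R P, N ⊔ LinearMap.ker f = ⊤ → N = ⊤

/-- A left `R`-module has a projective cover. -/
def HasProjectiveCover (R : Type u) [Ring R] (M : Type u) [AddCommGroup M] [Module R M] : Prop :=
  ∃ (P : ModuleCat.{u} R) (f : P →ₗ[R] M), IsProjectiveCover f

/-- `R` is left perfect: every left module has a projective cover. -/
def IsLeftPerfect (R : Type u) [Ring R] : Prop :=
  ∀ M : ModuleCat.{u} R, HasProjectiveCover R M

/-- `R` is semiperfect: every finitely generated left module has a projective cover. -/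
def IsSemiperfect (R : Type u) [Ring R] : Prop :=
  ∀ M : ModuleCat.{u} R, Module.Finite R M → HasProjectiveCover R M

/-- A two-sided ideal `K` of `R`, regarded as a right `R`-module, that is, as a submodule of `R`
over the opposite ring. -/
def rightModule {R : Type u} [Ring R] (K : Ideal R) [K.IsTwoSided] : Submodule Rᵐᵒᵖ R where
  carrier := K
  add_mem' := K.add_mem
  zero_mem' := K.zero_mem
  smul_mem' r _ hx := K.mul_mem_right r.unop hx

/-- The natural epimorphism `R → R ⧸ K` splits as a homomorphism of rings. -/
def SplitQuotient {R : Type u} [Ring R] (K : Ideal R) [K.IsTwoSided] : Prop :=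
  ∃ s : R ⧸ K →+* R, (Ideal.Quotient.mk K).comp s = RingHom.id (R ⧸ K)

end FinitisticDim

/-!
Write `Γ = Λ / K`, let `π : Λ → Γ` be the projection and `s : Γ → Λ` the splitting. Every bound comes
from one principle about extension of scalars `Ind φ = S ⊗_R -` along a ring homomorphism `φ : R → S`.
If the right module `S_R` has projective dimension at most `d`, then a `d`-th syzygy `M'` of any
`R`-module `M` satisfies `Tor_i(S, M') = 0` for `i ≥ 1`, so that `Ind φ` turns a projective resolution
of `M'` into one of `Ind φ M'`. Hence `pd (Ind φ M') ≤ pd M'`, with equality as soon as projectivity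
of acyclic modules is detected by `Ind φ` (`ReflectsProjective`), and then
`pd M ≤ pd (Ind φ M') + d` (`ReflectsProjective.exists_pd_le`).

* For `φ = π` one has `pd Γ_Λ ≤ pd K_Λ + 1`. Projectivity is detected because of the splitting: if
  `N = M / K M` is projective, the projective module `Ind s N` maps to `M` by a map which is bijective
  modulo `K`; its cokernel and kernel `C` satisfy `K C = C` and vanish by Nakayama's lemma
  (`reflectsProjective_mk`). Nakayama's lemma holds for finitely generated modules as `K ≤ J(Λ)`, and
  for all modules over left artinian or left perfect rings. This yields the upper bounds on the
  dimensions of `Λ`.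
* For `φ = s` and `K² = 0`, the right `Γ`-module `Λ` is `Γ ⊕ K`, of dimension at most `pd K_Λ`, and
  `Ind π (Ind s N) = N` detects projectivity (`reflectsProjective_section`). This yields the lower
  bounds in terms of `pd K_Λ`.
* As `Γ` is a retract of the ring `Λ`, every `Γ`-module `N` satisfies `pd_Γ N ≤ pd_Λ N`
  (`pd_le_of_semilinear_retract`). This gives `gd Γ ≤ gd Λ` without further assumptions, and the lower
  bounds for finitistic dimensions when `pd_Λ K`, hence `pd_Λ Γ`, is finite.

For the global dimension over a left noetherian ring, where Nakayama's lemma is available for finitely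
generated modules only, Auslander's theorem (`pd_le_of_forall_ideal`) reduces to cyclic modules.

Mathlib has neither tensor products nor `Tor` over noncommutative rings. `Ind φ M` is constructed as
a quotient of `S ⊗_ℤ M`, and the vanishing of `Tor_i(X, M)` is expressed through
`Ext^i(M, Hom_ℤ(X, ℚ/ℤ))`.
-/

namespace FinitisticDim

open CategoryTheory MulOpposite

/-! ### Projective dimension of modules -/

section ProjectiveDimension

variable {R : Type u} [Ring R] {L P M N : Type u} [AddCommGroup L] [Module R L]
  [AddCommGroup P] [Module R P] [AddCommGroup M] [Module R M] [AddCommGroup N] [Module R N]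

lemma pd_le_iff {n : ℕ} :
    pd R M ≤ n ↔ HasProjectiveDimensionLE (ModuleCat.of R M) n := by
  rw [← projectiveDimension_le_iff, pd]
  generalize projectiveDimension (ModuleCat.of R M) = x
  induction x with
  | bot => simp
  | coe a => exact (WithBot.coe_le_coe (b := (n : ℕ∞))).symm

lemma pd_le_zero_iff : pd R M ≤ 0 ↔ Module.Projective R M := by
  rw [← Nat.cast_zero, pd_le_iff, ← projective_iff_hasProjectiveDimensionLE_zero,
    IsProjective.iff_projective]

lemma pd_lt_top_iff : pd R M < ⊤ ↔ ∃ n : ℕ, pd R M ≤ n :=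
  ⟨fun h ↦ ⟨(pd R M).toNat, (ENat.natCast_toNat h.ne).ge⟩,
    fun ⟨n, h⟩ ↦ h.trans_lt (ENat.natCast_lt_top n)⟩

lemma pd_le_of_forall {x y : ℕ∞} (h : ∀ n : ℕ, y ≤ n → x ≤ n) : x ≤ y := by
  induction y with
  | top => exact le_top
  | coe n => exact h n le_rfl

lemma pd_le_of_retract (i : M →ₗ[R] N) (p : N →ₗ[R] M) (h : ∀ x, p (i x) = x) :
    pd R M ≤ pd R N := by
  refine pd_le_of_forall fun n hn ↦ ?_
  rw [pd_le_iff] at *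
  have r : Retract (ModuleCat.of R M) (ModuleCat.of R N) :=
    ⟨ModuleCat.ofHom i, ModuleCat.ofHom p, by ext x; exact h x⟩
  exact r.hasProjectiveDimensionLT _

variable {f : L →ₗ[R] P} {g : P →ₗ[R] M}

/-- The short complex in `ModuleCat R` underlying an exact pair of linear maps. -/
abbrev shortComplexOfExact (hfg : Function.Exact f g) : ShortComplex (ModuleCat.{u} R) :=
  ModuleCat.shortComplexOfCompEqZero f g hfg.linearMap_comp_eq_zero

lemma shortExact_of_exact (hf : Function.Injective f) (hfg : Function.Exact f g)
    (hg : Function.Surjective g) : (shortComplexOfExact hfg).ShortExact :=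
  ModuleCat.shortComplex_shortExact _ hfg hf hg

lemma pd_le_succ_iff [Module.Projective R P] (hf : Function.Injective f)
    (hfg : Function.Exact f g) (hg : Function.Surjective g) {n : ℕ} :
    pd R M ≤ (n + 1 : ℕ) ↔ pd R L ≤ n := by
  rw [pd_le_iff, pd_le_iff]
  exact (shortExact_of_exact hf hfg hg).hasProjectiveDimensionLT_X₃_iff n
    ((IsProjective.iff_projective P).1 inferInstance)

lemma pd_le_middle (hf : Function.Injective f)
    (hfg : Function.Exact f g) (hg : Function.Surjective g) {n : ℕ}
    (hL : pd R L ≤ n) (hM : pd R M ≤ n) : pd R P ≤ n := by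
  rw [pd_le_iff] at *
  exact (shortExact_of_exact hf hfg hg).hasProjectiveDimensionLT_X₂ (n + 1) hL hM

lemma pd_le_right (hf : Function.Injective f)
    (hfg : Function.Exact f g) (hg : Function.Surjective g) {n : ℕ}
    (hL : pd R L ≤ n) (hP : pd R P ≤ (n + 1 : ℕ)) : pd R M ≤ (n + 1 : ℕ) := by
  rw [pd_le_iff] at *
  exact (shortExact_of_exact hf hfg hg).hasProjectiveDimensionLT_X₃ (n + 1) hL hP

lemma pd_le_succ_iff_ker [Module.Projective R P] (hg : Function.Surjective g) {n : ℕ} :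
    pd R M ≤ (n + 1 : ℕ) ↔ pd R (LinearMap.ker g) ≤ n :=
  pd_le_succ_iff (LinearMap.ker g).injective_subtype g.exact_subtype_ker_map hg

lemma exists_projective_surjective (R : Type u) [Ring R] (M : Type u) [AddCommGroup M]
    [Module R M] : ∃ (P : ModuleCat.{u} R) (g : P →ₗ[R] M),
      Module.Projective R P ∧ Function.Surjective g :=
  ⟨ModuleCat.of R (M →₀ R), Finsupp.linearCombination R id,
    inferInstanceAs (Module.Projective R (M →₀ R)), Finsupp.linearCombination_id_surjective R M⟩

lemma exists_projective_finite_surjective (R : Type u) [Ring R] (M : Type u) [AddCommGroup M]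
    [Module R M] [Module.Finite R M] : ∃ (P : ModuleCat.{u} R) (g : P →ₗ[R] M),
      Module.Projective R P ∧ Module.Finite R P ∧ Function.Surjective g := by
  obtain ⟨n, g, hg⟩ := Module.Finite.exists_fin' R M
  exact ⟨ModuleCat.of R (Fin n → R), g, inferInstanceAs (Module.Projective R (Fin n → R)),
    inferInstanceAs (Module.Finite R (Fin n → R)), hg⟩

/-- Arbitrary direct powers do not raise the projective dimension. -/
lemma pd_finsupp_le (I : Type u) {n : ℕ} (h : pd R M ≤ n) : pd R (I →₀ M) ≤ n := by
  classical
  induction n generalizing M with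
  | zero =>
    rw [Nat.cast_zero, pd_le_zero_iff] at *
    exact Module.Projective.of_equiv (finsuppLequivDFinsupp R (M := M) (ι := I)).symm
  | succ n ih =>
    obtain ⟨P, g, hP, hg⟩ := exists_projective_surjective R M
    have : Module.Projective R (I →₀ P) := by
      exact Module.Projective.of_equiv (finsuppLequivDFinsupp R (M := P) (ι := I)).symm
    rw [pd_le_succ_iff_ker hg] at h
    refine (pd_le_succ_iff (f := Finsupp.mapRange.linearMap (LinearMap.ker g).subtype)
      (g := Finsupp.mapRange.linearMap g) ?_ ?_ ?_).2 (ih h)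
    · exact Finsupp.mapRange_injective _ (map_zero _) (Submodule.injective_subtype _)
    · intro x
      constructor
      · intro hx
        refine ⟨x.mapRange (fun y ↦ if hy : y ∈ LinearMap.ker g then ⟨y, hy⟩ else 0) (by simp), ?_⟩
        ext i
        have : g (x i) = 0 := by simpa using DFunLike.congr_fun hx i
        simp [this]
      · rintro ⟨y, rfl⟩
        ext i
        simp
    · exact Finsupp.mapRange_surjective _ (map_zero _) hg

end ProjectiveDimension

/-! ### Character duals and the vanishing of Tor -/

section Ext

open Abelian

variable {R : Type u} [Ring R] {L P M Y : Type u} [AddCommGroup L] [Module R L]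
  [AddCommGroup P] [Module R P] [AddCommGroup M] [Module R M] [AddCommGroup Y] [Module R Y]
  {f : L →ₗ[R] P} {g : P →ₗ[R] M}

lemma exists_extension_of_subsingleton_ext (hf : Function.Injective f)
    (hfg : Function.Exact f g) (hg : Function.Surjective g)
    (h : Subsingleton (Ext.{u} (ModuleCat.of R M) (ModuleCat.of R Y) 1)) (φ : L →ₗ[R] Y) :
    ∃ ψ : P →ₗ[R] Y, ∀ x, ψ (f x) = φ x := by
  obtain ⟨x, hx⟩ := Ext.contravariant_sequence_exact₁ (shortExact_of_exact hf hfg hg)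
    (ModuleCat.of R Y) (n₁ := 1) (Ext.mk₀ (ModuleCat.ofHom φ)) rfl (Subsingleton.elim _ _)
  obtain ⟨ψ, rfl⟩ := (Ext.mk₀_bijective _ _).2 x
  rw [Ext.mk₀_comp_mk₀] at hx
  refine ⟨ψ.hom, fun y ↦ ?_⟩
  exact LinearMap.congr_fun (ModuleCat.hom_ext_iff.1 ((Ext.mk₀_bijective _ _).1 hx)) y

lemma subsingleton_ext_of_projective [Module.Projective R P] (hf : Function.Injective f)
    (hfg : Function.Exact f g) (hg : Function.Surjective g) {i : ℕ} (hi : 1 ≤ i)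
    (h : Subsingleton (Ext.{u} (ModuleCat.of R M) (ModuleCat.of R Y) (1 + i))) :
    Subsingleton (Ext.{u} (ModuleCat.of R L) (ModuleCat.of R Y) i) := by
  refine subsingleton_of_forall_eq 0 fun x ↦ ?_
  obtain ⟨y, hy⟩ := Ext.contravariant_sequence_exact₁ (shortExact_of_exact hf hfg hg)
    (ModuleCat.of R Y) x rfl (Subsingleton.elim _ _)
  obtain ⟨i, rfl⟩ := Nat.exists_eq_add_of_le' hi
  have : Projective (shortComplexOfExact hfg).X₂ :=
    (IsProjective.iff_projective P).1 inferInstance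
  rw [← hy, y.eq_zero_of_projective, Ext.comp_zero]

end Ext

section CharacterDual

/-- The character dual `Hom_ℤ(X, ℚ/ℤ)` of an abelian group `X`. For a right `R`-module `X`
(a module over `Rᵐᵒᵖ`) it is a left `R`-module through `(r • f) x = f (x r)`; Mathlib's
`CharacterModule` carries a module structure over commutative rings only. -/
def CharDual (X : Type u) [AddCommGroup X] : Type u := X →+ AddCircle (1 : ℚ)

namespace CharDual

variable {R : Type u} [Ring R] {X Y Q : Type u} [AddCommGroup X] [Module Rᵐᵒᵖ X]
  [AddCommGroup Y] [Module Rᵐᵒᵖ Y] [AddCommGroup Q] [Module Rᵐᵒᵖ Q]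

instance : AddCommGroup (CharDual X) := inferInstanceAs (AddCommGroup (X →+ AddCircle (1 : ℚ)))

instance : FunLike (CharDual X) X (AddCircle (1 : ℚ)) :=
  inferInstanceAs (FunLike (X →+ AddCircle (1 : ℚ)) X _)

instance : AddMonoidHomClass (CharDual X) X (AddCircle (1 : ℚ)) :=
  inferInstanceAs (AddMonoidHomClass (X →+ AddCircle (1 : ℚ)) X _)

@[ext] lemma ext {f g : CharDual X} (h : ∀ x, f x = g x) : f = g := DFunLike.ext _ _ h

@[simp] lemma add_apply (f g : CharDual X) (x : X) : (f + g) x = f x + g x := rfl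

@[simp] lemma zero_apply (x : X) : (0 : CharDual X) x = 0 := rfl

instance : SMul R (CharDual X) :=
  ⟨fun r f ↦ AddMonoidHom.comp f (DistribSMul.toAddMonoidHom X (op r))⟩

@[simp] lemma smul_apply (r : R) (f : CharDual X) (x : X) : (r • f) x = f (op r • x) := rfl

instance : Module R (CharDual X) where
  one_smul f := by ext; simp
  mul_smul r s f := by ext; simp [mul_smul]
  smul_zero r := by ext; simp
  smul_add r f g := by ext; simp
  add_smul r s f := by ext; simp [add_smul]
  zero_smul f := by ext; simp

/-- The transpose of a homomorphism of right modules. -/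
def dual (f : X →ₗ[Rᵐᵒᵖ] Y) : CharDual Y →ₗ[R] CharDual X where
  toFun φ := AddMonoidHom.comp φ f.toAddMonoidHom
  map_add' _ _ := rfl
  map_smul' r φ := by ext x; exact congrArg φ (f.map_smul (op r) x).symm

@[simp] lemma dual_apply (f : X →ₗ[Rᵐᵒᵖ] Y) (φ : CharDual Y) (x : X) : dual f φ x = φ (f x) := rfl

lemma exists_extension {A B : Type u} [AddCommGroup A] [AddCommGroup B] (f : A →+ B)
    (hf : Function.Injective f) (φ : A →+ AddCircle (1 : ℚ)) :
    ∃ ψ : B →+ AddCircle (1 : ℚ), ∀ a, ψ (f a) = φ a := by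
  obtain ⟨ψ, hψ⟩ := (Module.Baer.of_divisible (AddCircle (1 : ℚ))).extension_property_addMonoidHom
    f hf φ
  exact ⟨ψ, fun a ↦ DFunLike.congr_fun hψ a⟩

lemma exists_apply_ne_zero {A : Type u} [AddCommGroup A] {a : A} (ha : a ≠ 0) :
    ∃ φ : A →+ AddCircle (1 : ℚ), φ a ≠ 0 := by
  by_contra! h
  exact ha (CharacterModule.eq_zero_of_character_apply h)

lemma dual_exact {f : X →ₗ[Rᵐᵒᵖ] Q} {g : Q →ₗ[Rᵐᵒᵖ] Y} (hfg : Function.Exact f g)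
    (hg : Function.Surjective g) : Function.Exact (dual g) (dual f) := by
  intro φ
  constructor
  · intro h
    have h' : ∀ q, g q = 0 → φ q = 0 := by
      intro q hq
      obtain ⟨x, rfl⟩ := (hfg q).1 hq
      exact DFunLike.congr_fun h x
    choose s hs using hg
    have key : ∀ q, φ (s (g q)) = φ q := fun q ↦ by
      rw [← sub_eq_zero, ← map_sub]
      exact h' _ (by simp [hs])
    refine ⟨AddMonoidHom.mk' (fun y ↦ φ (s y)) fun y z ↦ ?_, ?_⟩
    · rw [← map_add, ← sub_eq_zero, ← map_sub]
      exact h' _ (by simp [hs])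
    · ext q
      exact key q
  · rintro ⟨ψ, rfl⟩
    ext x
    simp [hfg.apply_apply_eq_zero]

lemma dual_injective {g : Q →ₗ[Rᵐᵒᵖ] Y} (hg : Function.Surjective g) :
    Function.Injective (dual g) := by
  intro φ ψ h
  ext y
  obtain ⟨q, rfl⟩ := hg y
  exact DFunLike.congr_fun h q

lemma dual_surjective {f : X →ₗ[Rᵐᵒᵖ] Q} (hf : Function.Injective f) :
    Function.Surjective (dual f) := by
  intro φ
  obtain ⟨ψ, hψ⟩ := exists_extension f.toAddMonoidHom hf φ
  exact ⟨ψ, ext hψ⟩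

/-- The character dual of a projective right module is injective. -/
instance injective_of_projective [Module.Projective Rᵐᵒᵖ X] : Module.Injective R (CharDual X) where
  out A B _ _ _ _ i hi f := by
    obtain ⟨s, hs⟩ := Module.projective_def.1 ‹Module.Projective Rᵐᵒᵖ X›
    -- the additive functionals `a ↦ f a y` are extended one by one and glued along a dual basis
    choose G hG using fun y : X ↦ exists_extension i.toAddMonoidHom hi
      (AddMonoidHom.mk' (fun a ↦ f a y) (by simp))
    let H (b : B) : (X →₀ Rᵐᵒᵖ) →+ AddCircle (1 : ℚ) := Finsupp.liftAddHom fun y ↦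
      AddMonoidHom.mk' (fun r ↦ G y (r.unop • b)) (by simp [add_smul])
    have H_apply (b : B) (w : X →₀ Rᵐᵒᵖ) : H b w = w.sum fun y r ↦ G y (r.unop • b) := by
      simp [H, Finsupp.liftAddHom_apply]
    refine ⟨{ toFun := fun b ↦ (H b).comp s.toAddMonoidHom, map_add' := ?_, map_smul' := ?_ }, ?_⟩
    · intro b c
      refine ext fun x ↦ ?_
      change H (b + c) (s x) = H b (s x) + H c (s x)
      simp only [H_apply, smul_add, map_add, Finsupp.sum_add]
    · intro r b
      refine ext fun x ↦ ?_
      change H (r • b) (s x) = H b (s (op r • x))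
      rw [map_smul, H_apply, H_apply, Finsupp.sum_smul_index (by simp)]
      simp [mul_smul]
    · intro a
      refine ext fun x ↦ ?_
      change H (i a) (s x) = f a x
      have key : ∀ w : X →₀ Rᵐᵒᵖ, H (i a) w = f a (Finsupp.linearCombination Rᵐᵒᵖ id w) := by
        intro w
        rw [H_apply, Finsupp.linearCombination_apply, Finsupp.sum, Finsupp.sum, map_sum]
        refine Finset.sum_congr rfl fun y _ ↦ ?_
        rw [← map_smul, show G y (i (_ • a)) = f (_ • a) y from hG y _, map_smul]
        simp
      rw [key, hs]

lemma hasInjectiveDimensionLE {n : ℕ} (h : pd Rᵐᵒᵖ X ≤ n) :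
    HasInjectiveDimensionLE (ModuleCat.of R (CharDual X)) n := by
  induction n generalizing X with
  | zero =>
    rw [Nat.cast_zero, pd_le_zero_iff] at h
    exact (injective_iff_hasInjectiveDimensionLT_one).1
      (Module.injective_object_of_injective_module R (CharDual X))
  | succ n ih =>
    obtain ⟨P, g, hP, hg⟩ := exists_projective_surjective Rᵐᵒᵖ X
    rw [pd_le_succ_iff_ker hg] at h
    refine ((shortExact_of_exact (dual_injective hg) (dual_exact g.exact_subtype_ker_map hg)
      (dual_surjective (LinearMap.ker g).injective_subtype)).hasInjectiveDimensionLT_X₃_iff n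
      ?_).1 (ih h)
    exact Module.injective_object_of_injective_module R (CharDual P)

end CharDual

end CharacterDual

section TorVanishing

open Abelian

variable {R : Type u} [Ring R] {L P M : Type u} [AddCommGroup L] [Module R L]
  [AddCommGroup P] [Module R P] [AddCommGroup M] [Module R M]
  {f : L →ₗ[R] P} {g : P →ₗ[R] M}

/-- `Tor_i^R(X, M) = 0` for all `i > d`, for a right module `X` and a left module `M`. Since
`Hom_ℤ(Tor_i(X, M), ℚ/ℤ)` is `Ext^i(M, Hom_ℤ(X, ℚ/ℤ))`, this is encoded as the vanishing of
`Ext` with values in the character dual of `X`. -/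
def TorVanishing (R X M : Type u) [Ring R] [AddCommGroup X] [Module Rᵐᵒᵖ X] [AddCommGroup M]
    [Module R M] (d : ℕ) : Prop :=
  ∀ i, d < i → Subsingleton (Ext.{u} (ModuleCat.of R M) (ModuleCat.of R (CharDual X)) i)

variable {X : Type u} [AddCommGroup X] [Module Rᵐᵒᵖ X]

lemma torVanishing_of_pd_le {d : ℕ} (h : pd Rᵐᵒᵖ X ≤ d) : TorVanishing R X M d := fun i hi ↦
  have := CharDual.hasInjectiveDimensionLE h
  HasInjectiveDimensionLT.subsingleton.{u} (ModuleCat.of R (CharDual X)) (d + 1) i hi _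

lemma TorVanishing.mono {d e : ℕ} (h : TorVanishing R X M d) (hde : d ≤ e) :
    TorVanishing R X M e := fun i hi ↦ h i (hde.trans_lt hi)

lemma TorVanishing.ker [Module.Projective R P] (hg : Function.Surjective g) {d : ℕ}
    (h : TorVanishing R X M (d + 1)) : TorVanishing R X (LinearMap.ker g) d := fun i hi ↦
  subsingleton_ext_of_projective (LinearMap.ker g).injective_subtype g.exact_subtype_ker_map hg
    (by lia) (h (1 + i) (by lia))

end TorVanishing

/-! ### Extension of scalars for noncommutative rings -/

section Ind

open TensorProduct

variable {R S T : Type u} [Ring R] [Ring S] [Ring T] (φ : R →+* S) {ψ : S →+* T} {χ : R →+* T}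
  {M N L P V : Type u} [AddCommGroup M] [Module R M] [AddCommGroup N] [Module R N]
  [AddCommGroup L] [Module R L] [AddCommGroup P] [Module R P] [AddCommGroup V] [Module T V]

/-- The submodule of `S ⊗_ℤ M` generated by the relations `φ r ⊗ m = 1 ⊗ r m`. -/
def Ind.relations (M : Type u) [AddCommGroup M] [Module R M] : Submodule S (S ⊗[ℤ] M) :=
  Submodule.span S {x | ∃ (r : R) (m : M), x = φ r ⊗ₜ m - 1 ⊗ₜ (r • m)}

/-- The extension of scalars `S ⊗_R M` of a left `R`-module along a homomorphism `R → S` of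
(noncommutative) rings: a quotient of `S ⊗_ℤ M`, as Mathlib's
tensor product requires a commutative base ring. -/
def Ind (M : Type u) [AddCommGroup M] [Module R M] : Type u :=
  (S ⊗[ℤ] M) ⧸ Ind.relations φ M

namespace Ind

noncomputable instance : AddCommGroup (Ind φ M) :=
  inferInstanceAs (AddCommGroup ((S ⊗[ℤ] M) ⧸ relations φ M))

noncomputable instance : Module S (Ind φ M) :=
  inferInstanceAs (Module S ((S ⊗[ℤ] M) ⧸ relations φ M))

/-- The canonical semilinear map `m ↦ 1 ⊗ m`. -/
noncomputable def unit (M : Type u) [AddCommGroup M] [Module R M] : M →ₛₗ[φ] Ind φ M where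
  toFun m := Submodule.Quotient.mk (1 ⊗ₜ m)
  map_add' m n := by rw [tmul_add]; rfl
  map_smul' r m := by
    have h : φ r ⊗ₜ[ℤ] m - 1 ⊗ₜ (r • m) ∈ relations φ M := Submodule.subset_span ⟨r, m, rfl⟩
    change _ = (Submodule.Quotient.mk (φ r • (1 ⊗ₜ m)) : (S ⊗[ℤ] M) ⧸ relations φ M)
    rw [smul_tmul', smul_eq_mul, mul_one]
    exact ((Submodule.Quotient.eq _).2 h).symm

@[elab_as_elim]
lemma induction_on {p : Ind φ M → Prop} (x : Ind φ M) (zero : p 0)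
    (smul_unit : ∀ (s : S) (m : M), p (s • unit φ M m))
    (add : ∀ x y, p x → p y → p (x + y)) : p x := by
  obtain ⟨x, rfl⟩ := Submodule.Quotient.mk_surjective _ x
  induction x with
  | zero => exact zero
  | tmul s m =>
    have := smul_unit s m
    change p (Submodule.Quotient.mk (s • (1 ⊗ₜ m))) at this
    rwa [smul_tmul', smul_eq_mul, mul_one] at this
  | add x y hx hy => exact add _ _ hx hy

/-- The map `s ⊗ m ↦ ψ s • f m` on `S ⊗_ℤ M`. -/
noncomputable def liftAux (ψ : S →+* T) (f : M →ₛₗ[χ] V) [RingHomCompTriple φ ψ χ] :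
    S ⊗[ℤ] M →ₛₗ[ψ] V where
  __ := TensorProduct.liftAddHom (R := ℤ)
    (AddMonoidHom.mk' (fun s : S ↦ AddMonoidHom.mk' (fun m : M ↦ ψ s • f m) (by simp))
      (fun s t ↦ by ext; simp [add_smul])) (fun r s m ↦ by
      change ψ (r • s) • f m = ψ s • f (r • m)
      rw [map_zsmul, map_zsmul, smul_assoc, smul_comm])
  map_smul' s x := by
    induction x with
    | zero => simp
    | tmul t m => simp [smul_tmul', mul_smul]
    | add x y hx hy => simp_all

/-- The universal property of extension of scalars, for maps which are semilinear along a
composite `R → S → T`. -/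
noncomputable def lift (ψ : S →+* T) (f : M →ₛₗ[χ] V) [RingHomCompTriple φ ψ χ] :
    Ind φ M →ₛₗ[ψ] V :=
  Submodule.liftQ (relations φ M) (liftAux φ ψ f) <| by
    rw [relations, Submodule.span_le]
    rintro _ ⟨r, m, rfl⟩
    change liftAux φ ψ f _ = 0
    simp [liftAux, RingHomCompTriple.comp_apply]

variable {φ}

@[simp] lemma lift_unit (f : M →ₛₗ[χ] V) [RingHomCompTriple φ ψ χ] (m : M) :
    lift φ ψ f (unit φ M m) = f m := by
  change liftAux φ ψ f (1 ⊗ₜ m) = f m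
  simp [liftAux]

lemma hom_ext {f g : Ind φ M →ₛₗ[ψ] V} (h : ∀ m, f (unit φ M m) = g (unit φ M m)) (x : Ind φ M) :
    f x = g x := by
  induction x using induction_on with
  | zero => simp
  | smul_unit s m => simp [h]
  | add x y hx hy => simp [hx, hy]

lemma span_range_unit : Submodule.span S (Set.range (unit φ M)) = ⊤ := by
  refine eq_top_iff.2 fun x _ ↦ ?_
  induction x using induction_on with
  | zero => exact zero_mem _
  | smul_unit s m => exact Submodule.smul_mem _ _ (Submodule.subset_span ⟨m, rfl⟩)
  | add x y hx hy => exact add_mem (hx trivial) (hy trivial)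

variable (φ) in
/-- Functoriality of extension of scalars. -/
noncomputable def map (f : M →ₗ[R] N) : Ind φ M →ₗ[S] Ind φ N :=
  lift φ (RingHom.id S) ((unit φ N).comp f)

@[simp] lemma map_unit (f : M →ₗ[R] N) (m : M) : map φ f (unit φ M m) = unit φ N (f m) :=
  lift_unit _ _

lemma map_surjective {f : M →ₗ[R] N} (hf : Function.Surjective f) :
    Function.Surjective (map φ f) := by
  intro x
  induction x using induction_on with
  | zero => exact ⟨0, map_zero _⟩
  | smul_unit s m =>
    obtain ⟨m, rfl⟩ := hf m
    exact ⟨s • unit φ M m, by simp⟩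
  | add x y hx hy =>
    obtain ⟨x, rfl⟩ := hx
    obtain ⟨y, rfl⟩ := hy
    exact ⟨x + y, map_add _ _ _⟩

/-- Extension of scalars is right exact. -/
lemma map_exact {f : L →ₗ[R] P} {g : P →ₗ[R] M} (hfg : Function.Exact f g)
    (hg : Function.Surjective g) : Function.Exact (map φ f) (map φ g) := by
  intro y
  constructor
  · intro hy
    let W := LinearMap.range (map φ f)
    choose s hs using hg
    have key : ∀ p, g p = 0 → W.mkQ (unit φ P p) = 0 := by
      intro p hp
      obtain ⟨l, rfl⟩ := (hfg p).1 hp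
      exact (Submodule.Quotient.mk_eq_zero W).2 ⟨unit φ L l, by simp⟩
    have key' : ∀ p q, g p = g q → W.mkQ (unit φ P p) = W.mkQ (unit φ P q) := by
      intro p q h
      rw [← sub_eq_zero, ← map_sub, ← map_sub]
      exact key _ (by simp [h])
    let h : M →ₛₗ[φ] (Ind φ P ⧸ W) :=
      { toFun := fun m ↦ W.mkQ (unit φ P (s m))
        map_add' := fun m n ↦ by
          rw [← map_add, ← map_add]
          exact key' _ _ (by simp [hs])
        map_smul' := fun r m ↦ by
          rw [← map_smul, ← map_smulₛₗ]
          exact key' _ _ (by simp [hs]) }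
    have hinv : ((lift φ (RingHom.id S) h).comp (map φ g)) y = W.mkQ y := by
      refine hom_ext (fun p ↦ ?_) y
      rw [LinearMap.comp_apply, map_unit, lift_unit]
      exact key' _ _ (hs _)
    rw [LinearMap.comp_apply, hy, map_zero] at hinv
    exact (Submodule.Quotient.mk_eq_zero W).1 hinv.symm
  · rintro ⟨x, rfl⟩
    have : ((map φ g).comp (map φ f)) x = (0 : Ind φ L →ₗ[S] Ind φ M) x :=
      hom_ext (fun l ↦ by simp [hfg.apply_apply_eq_zero]) x
    simpa using this

instance finite [Module.Finite R M] : Module.Finite S (Ind φ M) := by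
  obtain ⟨s, hs⟩ := Module.Finite.fg_top (R := R) (M := M)
  classical
  refine ⟨⟨s.image (unit φ M), ?_⟩⟩
  rw [eq_top_iff, ← span_range_unit, Submodule.span_le]
  rintro _ ⟨m, rfl⟩
  have hm : m ∈ Submodule.span R (s : Set M) := hs ▸ Submodule.mem_top
  induction hm using Submodule.span_induction with
  | mem x hx => exact Submodule.subset_span (Finset.coe_image (f := unit φ M) ▸ ⟨x, hx, rfl⟩)
  | zero => simp
  | add x y _ _ hx hy => simpa using add_mem hx hy
  | smul r x _ hx => simpa using Submodule.smul_mem _ (φ r) hx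

end Ind

/-- Projective modules lift semilinear maps through surjections. -/
lemma exists_semilinear_lift [Module.Projective R P] {M Q : Type u} [AddCommGroup M] [Module S M]
    [AddCommGroup Q] [Module S Q] {φ : R →+* S} (f : P →ₛₗ[φ] M) (g : Q →ₗ[S] M)
    (hg : Function.Surjective g) : ∃ h : P →ₛₗ[φ] Q, ∀ x, g (h x) = f x := by
  let : Module R M := Module.compHom M φ
  let : Module R Q := Module.compHom Q φ
  let f' : P →ₗ[R] M := { f with map_smul' := fun r x ↦ f.map_smulₛₗ r x }
  let g' : Q →ₗ[R] M := { g with map_smul' := fun r x ↦ g.map_smul (φ r) x }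
  obtain ⟨h, hh⟩ := Module.projective_lifting_property g' f' hg
  exact ⟨{ h with map_smul' := fun r x ↦ h.map_smul r x }, fun x ↦ LinearMap.congr_fun hh x⟩

namespace Ind

variable {φ}

instance projective [Module.Projective R P] : Module.Projective S (Ind φ P) := by
  refine Module.Projective.of_lifting_property'' fun f hf ↦ ?_
  obtain ⟨h, hh⟩ := exists_semilinear_lift (unit φ P) f hf
  exact ⟨lift φ (RingHom.id S) h, LinearMap.ext fun x ↦
    hom_ext (f := f.comp (lift φ (RingHom.id S) h)) (g := LinearMap.id) (by simp [hh]) x⟩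

end Ind

/-- The ring `S` as a right `R`-module, by restriction along `φ : R → S`. -/
def RightRestriction (_ : R →+* S) : Type u := S

namespace RightRestriction

instance : AddCommGroup (RightRestriction φ) := inferInstanceAs (AddCommGroup S)

instance : SMul Rᵐᵒᵖ (RightRestriction φ) := ⟨fun r s ↦ (show S from s) * φ r.unop⟩

instance : Module Rᵐᵒᵖ (RightRestriction φ) where
  one_smul (s : S) := show s * φ 1 = s by rw [map_one, mul_one]
  mul_smul r t (s : S) := show s * φ (t.unop * r.unop) = s * φ t.unop * φ r.unop by
    rw [map_mul, mul_assoc]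
  smul_zero r := show (0 : S) * φ r.unop = 0 from zero_mul _
  smul_add r (s t : S) := add_mul s t (φ r.unop)
  add_smul r t (s : S) := show s * φ (r.unop + t.unop) = s * φ r.unop + s * φ t.unop by
    rw [map_add, mul_add]
  zero_smul (s : S) := show s * φ 0 = 0 by rw [map_zero, mul_zero]

/-- The identity of `S`, as a map to its right restriction. -/
def of : S ≃+ RightRestriction φ := AddEquiv.refl S

lemma op_smul_of (r : R) (s : S) : op r • of φ s = of φ (s * φ r) := rfl

end RightRestriction

/-- Extension of scalars preserves the exactness of `0 → L → P → M → 0` on the left as soon as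
`Tor_1(S, M)` vanishes: a character of `S ⊗ L` is an `R`-linear map from `L` to the character
dual of `S`, and it extends to `P`. -/
lemma Ind.map_injective {φ : R →+* S} {f : L →ₗ[R] P} {g : P →ₗ[R] M}
    (hf : Function.Injective f) (hfg : Function.Exact f g) (hg : Function.Surjective g)
    (hM : TorVanishing R (RightRestriction φ) M 0) : Function.Injective (map φ f) := by
  rw [injective_iff_map_eq_zero]
  intro x hx
  by_contra hx0
  obtain ⟨c, hc⟩ := CharDual.exists_apply_ne_zero hx0
  let Φ : L →ₗ[R] CharDual (RightRestriction φ) :=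
    { toFun := fun l ↦ AddMonoidHom.mk'
        (fun s ↦ c ((RightRestriction.of φ).symm s • unit φ L l)) (by simp [add_smul])
      map_add' := fun l m ↦ by
        ext s
        change c (_ • _) = c (_ • _) + c (_ • _)
        simp
      map_smul' := fun r l ↦ by
        ext s
        obtain ⟨s, rfl⟩ := (RightRestriction.of φ).surjective s
        change c (s • unit φ L (r • l)) = c ((s * φ r) • unit φ L l)
        rw [(unit φ L).map_smulₛₗ, mul_smul] }
  obtain ⟨Ψ, hΨ⟩ := exists_extension_of_subsingleton_ext hf hfg hg (hM 1 one_pos) Φ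
  let Ψ' : P →ₛₗ[φ] CharDual (RightRestriction (RingHom.id S)) :=
    { toFun := fun p ↦ (show S →+ AddCircle (1 : ℚ) from Ψ p)
      map_add' := fun p q ↦ Ψ.map_add p q
      map_smul' := fun r p ↦ Ψ.map_smul r p }
  have key : ∀ y (s : S), lift φ (RingHom.id S) Ψ' (map φ f y)
      (RightRestriction.of (RingHom.id S) s) = c (s • y) := by
    intro y
    induction y using induction_on with
    | zero => simp
    | smul_unit t l =>
      intro s
      rw [map_smul, map_smul, map_unit, lift_unit, CharDual.smul_apply,
        RightRestriction.op_smul_of, ← mul_smul]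
      exact DFunLike.congr_fun (hΨ l) (RightRestriction.of φ (s * t))
    | add y z hy hz =>
      intro s
      rw [map_add, map_add, CharDual.add_apply, hy, hz, smul_add, map_add]
  apply hc
  rw [← one_smul S x, ← key x 1, hx]
  simp

end Ind

/-! ### Projective dimension under extension of scalars and retracts of rings -/

section Comparison

/-- The class of all modules (if `big` holds) or of the finitely generated ones (otherwise). It
serves to treat the big and the little finitistic dimension at once. -/
def Admissible (big : Prop) (R M : Type u) [Ring R] [AddCommGroup M] [Module R M] : Prop :=
  big ∨ Module.Finite R M

variable {big : Prop} {R S : Type u} [Ring R] [Ring S] {φ : R →+* S} {L P M N : Type u}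
  [AddCommGroup L] [Module R L] [AddCommGroup P] [Module R P] [AddCommGroup M] [Module R M]
  [AddCommGroup N] [Module R N]

lemma Admissible.of_surjective (hM : Admissible big R M) (f : M →ₗ[R] N)
    (hf : Function.Surjective f) : Admissible big R N :=
  hM.imp_right fun (_ : Module.Finite R M) ↦ Module.Finite.of_surjective f hf

lemma Admissible.submodule (hR : big ∨ IsNoetherianRing R) (hM : Admissible big R M)
    (W : Submodule R M) : Admissible big R W := by
  rcases hR with h | _
  · exact Or.inl h
  · exact hM.imp_right fun (_ : Module.Finite R M) ↦ inferInstance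

lemma Admissible.ind (hM : Admissible big R M) : Admissible big S (Ind φ M) :=
  hM.imp_right fun (_ : Module.Finite R M) ↦ inferInstance

lemma Admissible.exists_projective_surjective (hM : Admissible big R M) :
    ∃ (P : ModuleCat.{u} R) (g : P →ₗ[R] M),
      Module.Projective R P ∧ Admissible big R P ∧ Function.Surjective g := by
  rcases hM with h | _
  · obtain ⟨P, g, hP, hg⟩ := FinitisticDim.exists_projective_surjective R M
    exact ⟨P, g, hP, Or.inl h, hg⟩
  · obtain ⟨P, g, hP, hfin, hg⟩ := exists_projective_finite_surjective R M
    exact ⟨P, g, hP, Or.inr hfin, hg⟩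

/-- Extension of scalars takes a projective resolution of an acyclic module to a projective
resolution. -/
lemma pd_ind_le {n : ℕ} (hM : TorVanishing R (RightRestriction φ) M 0) (h : pd R M ≤ n) :
    pd S (Ind φ M) ≤ n := by
  induction n generalizing M with
  | zero =>
    rw [Nat.cast_zero, pd_le_zero_iff] at *
    infer_instance
  | succ n ih =>
    obtain ⟨P, g, hP, hg⟩ := exists_projective_surjective R M
    rw [pd_le_succ_iff_ker hg] at h
    have hker := (LinearMap.ker g).injective_subtype
    exact (pd_le_succ_iff (Ind.map_injective hker g.exact_subtype_ker_map hg hM)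
      (Ind.map_exact g.exact_subtype_ker_map hg) (Ind.map_surjective hg)).2
      (ih ((hM.mono zero_le_one).ker hg) h)

/-- A module in the class which is acyclic for extension of scalars along `φ` is projective as soon
as its extension of scalars is. -/
def ReflectsProjective (big : Prop) (φ : R →+* S) : Prop :=
  ∀ M : ModuleCat.{u} R, Admissible big R M → TorVanishing R (RightRestriction φ) M 0 →
    Module.Projective S (Ind φ M) → Module.Projective R M

/-- The converse bound to `pd_ind_le`: the first projective syzygy of `Ind φ M` is the extension of
scalars of a projective syzygy of `M`. -/
lemma ReflectsProjective.pd_le (hφ : ReflectsProjective big φ) (hR : big ∨ IsNoetherianRing R)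
    {n : ℕ} (hadm : Admissible big R M) (hM : TorVanishing R (RightRestriction φ) M 0)
    (h : pd S (Ind φ M) ≤ n) : pd R M ≤ n := by
  induction n generalizing M with
  | zero =>
    rw [Nat.cast_zero, pd_le_zero_iff] at *
    exact hφ (ModuleCat.of R M) hadm hM h
  | succ n ih =>
    obtain ⟨P, g, hP, hPadm, hg⟩ := hadm.exists_projective_surjective
    have hker := (LinearMap.ker g).injective_subtype
    rw [pd_le_succ_iff (Ind.map_injective hker g.exact_subtype_ker_map hg hM)
      (Ind.map_exact g.exact_subtype_ker_map hg) (Ind.map_surjective hg)] at h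
    rw [pd_le_succ_iff_ker hg]
    exact ih (hPadm.submodule hR _) ((hM.mono zero_le_one).ker hg) h

/-- A `d`-th syzygy of a module with `Tor_i(X, M) = 0` for `i > d`. -/
lemma exists_acyclic_syzygy {X : Type u} [AddCommGroup X] [Module Rᵐᵒᵖ X]
    (hR : big ∨ IsNoetherianRing R) {d : ℕ} (hadm : Admissible big R M)
    (hM : TorVanishing R X M d) : ∃ N : ModuleCat.{u} R, Admissible big R N ∧
      TorVanishing R X N 0 ∧ (pd R M < ⊤ → pd R N < ⊤) ∧ pd R M ≤ pd R N + d := by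
  induction d generalizing M with
  | zero => exact ⟨ModuleCat.of R M, hadm, hM, id, by simp⟩
  | succ d ih =>
    obtain ⟨P, g, hP, hPadm, hg⟩ := hadm.exists_projective_surjective
    obtain ⟨N, hN, hNtor, hfin, hle⟩ := ih (hPadm.submodule hR (LinearMap.ker g)) (hM.ker hg)
    refine ⟨N, hN, hNtor, fun h ↦ hfin ?_, ?_⟩
    · obtain ⟨n, hn⟩ := pd_lt_top_iff.1 h
      exact pd_lt_top_iff.2 ⟨n, (pd_le_succ_iff_ker hg).1
        (hn.trans (Nat.cast_le.2 n.le_succ))⟩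
    · have h1 : pd R M ≤ pd R (LinearMap.ker g) + 1 := by
        refine pd_le_of_forall fun n hn ↦ ?_
        obtain ⟨k, hk⟩ := ENat.ne_top_iff_exists.1
          (ne_top_of_le_ne_top (ENat.natCast_ne_top n) (le_self_add.trans hn))
        refine le_trans ?_ hn
        rw [← hk]
        exact_mod_cast (pd_le_succ_iff_ker hg).2 hk.ge
      calc pd R M ≤ pd R (LinearMap.ker g) + 1 := h1
        _ ≤ pd R N + d + 1 := by gcongr
        _ = pd R N + (d + 1 : ℕ) := by push_cast; rw [add_assoc]

/-- Comparison of projective dimensions along extension of scalars: a `d`-th syzygy of `M` is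
acyclic, and for acyclic modules extension of scalars preserves the projective dimension. -/
lemma ReflectsProjective.exists_pd_le (hφ : ReflectsProjective big φ)
    (hR : big ∨ IsNoetherianRing R) {d : ℕ} (hd : pd Rᵐᵒᵖ (RightRestriction φ) ≤ d)
    (hadm : Admissible big R M) : ∃ N : ModuleCat.{u} S, Admissible big S N ∧
      (pd R M < ⊤ → pd S N < ⊤) ∧ pd R M ≤ pd S N + d := by
  obtain ⟨N, hN, hNtor, hfin, hle⟩ := exists_acyclic_syzygy hR hadm (torVanishing_of_pd_le hd)
  refine ⟨ModuleCat.of S (Ind φ N), hN.ind, fun h ↦ ?_, hle.trans ?_⟩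
  · obtain ⟨n, hn⟩ := pd_lt_top_iff.1 (hfin h)
    exact pd_lt_top_iff.2 ⟨n, pd_ind_le hNtor hn⟩
  · gcongr
    exact pd_le_of_forall fun n hn ↦ hφ.pd_le hR hN hNtor hn

end Comparison

section Retract

variable {A B : Type u} [Ring A] [Ring B] {ι : A →+* B} {π : B →+* A}
  {M N : Type u} [AddCommGroup M] [Module B M] [AddCommGroup N] [Module A N]

lemma projective_of_semilinear_retract (hπι : π.comp ι = RingHom.id A) [Module.Projective B M]
    (α : M →ₛₗ[π] N) (β : N →ₛₗ[ι] M) (h : ∀ x, α (β x) = x) : Module.Projective A N := by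
  have : RingHomCompTriple ι π (RingHom.id A) := ⟨hπι⟩
  let i : N →ₗ[A] Ind π M := (Ind.unit π M).comp β
  refine Module.Projective.of_split i (Ind.lift π (RingHom.id A) α) (LinearMap.ext fun x ↦ ?_)
  simp [i, h]

/-- If `A` is a retract of the ring `B`, and the `A`-module `N` is a retract of the `B`-module `M`
through maps which are semilinear along `B → A` and `A → B`, then `pd_A N ≤ pd_B M`. -/
lemma pd_le_of_semilinear_retract (hπι : π.comp ι = RingHom.id A)
    (α : M →ₛₗ[π] N) (β : N →ₛₗ[ι] M) (h : ∀ x, α (β x) = x) : pd A N ≤ pd B M := by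
  refine pd_le_of_forall fun n hn ↦ ?_
  have : RingHomCompTriple ι π (RingHom.id A) := ⟨hπι⟩
  induction n generalizing M N with
  | zero =>
    rw [Nat.cast_zero, pd_le_zero_iff] at *
    exact projective_of_semilinear_retract hπι α β h
  | succ n ih =>
    obtain ⟨Q, g, hQ, hg⟩ := exists_projective_surjective B M
    obtain ⟨P, k, hP, hk⟩ := exists_projective_surjective A N
    obtain ⟨α₀, hα₀⟩ := exists_semilinear_lift (α.comp g) k hk
    obtain ⟨β₀, hβ₀⟩ := exists_semilinear_lift (β.comp k) g hg
    simp only [LinearMap.comp_apply] at hα₀ hβ₀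
    -- the lifts `α₀`, `β₀` form a retraction up to the map `δ` into `ker k`; the defect is
    -- absorbed by the projective summand `Ind ι P` added to `Q`
    let δ : P →ₗ[A] P := LinearMap.id - α₀.comp β₀
    have hδ : ∀ p, δ p = p - α₀ (β₀ p) := fun p ↦ rfl
    let γ : Ind ι P →ₛₗ[π] P := Ind.lift ι π δ
    have hkγ : ∀ y, k (γ y) = 0 := fun y ↦
      Ind.hom_ext (f := k.comp γ) (g := (0 : Ind ι P →ₛₗ[π] N))
        (fun p ↦ by simp [γ, hδ, hα₀, hβ₀, h]) y
    let g' : Q × Ind ι P →ₗ[B] M := g.comp (LinearMap.fst B Q (Ind ι P))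
    have hg' : Function.Surjective g' := hg.comp Prod.fst_surjective
    let α' : Q × Ind ι P →ₛₗ[π] P :=
      α₀.comp (LinearMap.fst B Q (Ind ι P)) + γ.comp (LinearMap.snd B Q (Ind ι P))
    let β' : P →ₛₗ[ι] Q × Ind ι P :=
      { toFun := fun p ↦ (β₀ p, Ind.unit ι P p)
        map_add' := fun p q ↦ by simp
        map_smul' := fun a p ↦ by simp }
    have hα' : ∀ x ∈ LinearMap.ker g', α' x ∈ LinearMap.ker k := by
      rintro ⟨q, y⟩ hq
      have hq : g q = 0 := hq
      simp [α', hkγ, hα₀, hq]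
    have hβ' : ∀ p ∈ LinearMap.ker k, β' p ∈ LinearMap.ker g' := by
      intro p hp
      have hp : k p = 0 := hp
      simp [β', g', hβ₀, hp]
    rw [pd_le_succ_iff_ker hk]
    rw [pd_le_succ_iff_ker hg'] at hn
    refine ih ((α'.domRestrict _).codRestrict _ fun x ↦ hα' x x.2)
      ((β'.domRestrict _).codRestrict _ fun x ↦ hβ' x x.2) (fun x ↦ ?_) hn
    ext
    change α₀ (β₀ x) + γ (Ind.unit ι P x) = x
    simp [γ, hδ]

end Retract

/-! ### Nakayama's lemma and the detection of projectivity -/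

section Nakayama

variable {R : Type u} [Ring R] {K : Ideal R}

lemma isUnit_one_sub_of_mem_jacobson {x : R} (hx : x ∈ Ideal.jacobson (⊥ : Ideal R)) :
    IsUnit (1 - x) := by
  have left_inverse : ∀ y ∈ Ideal.jacobson (⊥ : Ideal R), ∃ z, z * (1 - y) = 1 := by
    intro y hy
    obtain ⟨z, hz⟩ := Ideal.mem_jacobson_iff.1 hy (-1)
    exact ⟨z, by rw [← sub_eq_zero, ← (Submodule.mem_bot R).1 hz]; noncomm_ring⟩
  obtain ⟨z, hz⟩ := left_inverse x hx
  obtain ⟨w, hw⟩ := left_inverse (-(z * x)) (neg_mem (Ideal.mul_mem_left _ z hx))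
  -- `z = 1 + z x` has the left inverse `w`, hence it is a two-sided inverse of `1 - x`
  have hz' : 1 - -(z * x) = z := by
    rw [sub_neg_eq_add, ← eq_sub_iff_add_eq, ← hz, mul_sub, mul_one]
  rw [hz'] at hw
  have : w = 1 - x := left_inv_eq_right_inv hw hz
  exact ⟨⟨1 - x, z, by rw [← this, hw], hz⟩, rfl⟩

/-- An endomorphism of a free module whose matrix has its entries in the Jacobson radical has no
nonzero fixed vector. -/
lemma eq_zero_of_fixed {I : Type u} (e : (I →₀ R) →ₗ[R] (I →₀ R))
    (he : ∀ i j, e (Finsupp.single i 1) j ∈ Ring.jacobson R) {p : I →₀ R} (hp : e p = p) :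
    p = 0 := by
  classical
  let A : Matrix p.support p.support R := fun i j ↦ e (Finsupp.single i.1 1) j.1
  let c : p.support → R := fun i ↦ p i
  have hcA : Matrix.vecMul c A = c := by
    funext j
    have h1 : p = ∑ i ∈ p.support, p i • Finsupp.single i (1 : R) := by
      conv_lhs => rw [← Finsupp.sum_single p, Finsupp.sum]
      simp
    have h2 : e p j.1 = ∑ i ∈ p.support, p i * e (Finsupp.single i 1) j.1 := by
      refine (congrArg (fun x ↦ e x j.1) h1).trans ?_
      simp only [map_sum, Finsupp.finsetSum_apply, map_smul, Finsupp.smul_apply, smul_eq_mul]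
    rw [hp, ← Finset.sum_coe_sort] at h2
    exact h2.symm
  have hA : A ∈ Ideal.jacobson (⊥ : Ideal (Matrix p.support p.support R)) := by
    have := Ideal.matrix_jacobson_le (n := p.support) (⊥ : Ideal R)
      (show A ∈ _ from fun i j ↦ Ideal.jacobson_bot (R := R) ▸ he i j)
    rwa [Ideal.matrix_bot] at this
  obtain ⟨U, hU⟩ := isUnit_one_sub_of_mem_jacobson hA
  have hc : c = 0 := by
    have h0 : Matrix.vecMul c (U : Matrix p.support p.support R) = 0 := by
      rw [hU, Matrix.vecMul_sub, Matrix.vecMul_one, hcA, sub_self]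
    calc c = Matrix.vecMul c ((U : Matrix p.support p.support R) * ↑U⁻¹) := by
          rw [Units.mul_inv, Matrix.vecMul_one]
      _ = 0 := by rw [← Matrix.vecMul_vecMul, h0, Matrix.zero_vecMul]
  ext i
  by_cases hi : i ∈ p.support
  · exact congrFun hc ⟨i, hi⟩
  · simpa using hi

lemma coord_mem_of_mem_smul_top [K.IsTwoSided] {I : Type u} {x : I →₀ R}
    (hx : x ∈ K • (⊤ : Submodule R (I →₀ R))) (j : I) : x j ∈ K := by
  induction hx using Submodule.smul_induction_on' with
  | smul r hr n _ => exact K.mul_mem_right _ hr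
  | add x _ y _ hx hy => exact K.add_mem hx hy

/-- Nakayama's lemma for an ideal `K` and all modules, respectively all finitely generated ones. -/
def HasNakayama (big : Prop) (K : Ideal R) : Prop :=
  ∀ C : ModuleCat.{u} R, Admissible big R C → K • (⊤ : Submodule R C) = ⊤ → Subsingleton C

lemma hasNakayama_finite (hK : K ≤ Ring.jacobson R) : HasNakayama False K := by
  rintro C (h | hC) htop
  · exact h.elim
  · refine (Submodule.subsingleton_iff R).1 (subsingleton_of_bot_eq_top ?_)
    refine (Submodule.FG.eq_bot_of_le_jacobson_smul Module.Finite.fg_top ?_).symm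
    exact htop.ge.trans (Submodule.smul_mono_left hK)

lemma hasNakayama_of_isArtinianRing [IsArtinianRing R] (hK : K ≤ Ring.jacobson R) :
    HasNakayama True K := by
  rintro C - htop
  obtain ⟨n, hn⟩ := IsSemiprimaryRing.isNilpotent (R := R)
  have hJ : Ring.jacobson R • (⊤ : Submodule R C) = ⊤ :=
    top_le_iff.1 (htop.ge.trans (Submodule.smul_mono_left hK))
  have hpow : ∀ m, Ring.jacobson R ^ m • (⊤ : Submodule R C) = ⊤ := by
    intro m
    induction m with
    | zero => rw [Submodule.pow_zero, Ideal.one_eq_top, Submodule.top_smul]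
    | succ m ih => rw [Submodule.pow_succ, Submodule.mul_smul, hJ, ih]
  have := hpow n
  rw [hn, Submodule.zero_eq_bot, Submodule.bot_smul] at this
  exact (Submodule.subsingleton_iff R).1 (subsingleton_of_bot_eq_top this)

/-- Over a left perfect ring, `K F` is superfluous in every free module `F`: a projective cover of
`F / K F` is a direct summand of `F` with complement inside `K F`, and that complement vanishes. -/
lemma hasNakayama_of_isLeftPerfect [K.IsTwoSided] (hR : IsLeftPerfect R)
    (hK : K ≤ Ring.jacobson R) : HasNakayama True K := by
  rintro C - htop
  let F := C →₀ R
  let KF : Submodule R F := K • ⊤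
  let t : F →ₗ[R] C := Finsupp.linearCombination R id
  have ht : Function.Surjective t := Finsupp.linearCombination_id_surjective R C
  have hsup : LinearMap.ker t ⊔ KF = ⊤ := by
    have hmap : KF.map t = ⊤ := by
      rw [Submodule.map_smul'', Submodule.map_top, LinearMap.range_eq_top.2 ht, htop]
    rw [sup_comm, ← Submodule.comap_map_eq, hmap, Submodule.comap_top]
  obtain ⟨P, p, hp⟩ := hR (ModuleCat.of R (F ⧸ KF))
  have := hp.projective
  obtain ⟨q, hq⟩ := Module.projective_lifting_property p KF.mkQ hp.surjective
  have hqx : ∀ x, p (q x) = KF.mkQ x := fun x ↦ LinearMap.congr_fun hq x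
  have hq_surj : Function.Surjective q := by
    refine LinearMap.range_eq_top.1 (hp.superfluous _ (eq_top_iff.2 fun x _ ↦ ?_))
    obtain ⟨y, hy⟩ := KF.mkQ_surjective (p x)
    rw [← sub_add_cancel x (q y), add_comm]
    exact Submodule.add_mem_sup ⟨y, rfl⟩ (by simp [hqx, hy])
  obtain ⟨s, hs⟩ := Module.projective_lifting_property q LinearMap.id hq_surj
  have hsx : ∀ x, q (s x) = x := fun x ↦ LinearMap.congr_fun hs x
  -- the projection of `F` onto the complement `ker q`
  let e : F →ₗ[R] F := LinearMap.id - s.comp q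
  have hex : ∀ x, e x = x - s (q x) := fun x ↦ rfl
  have hqe : ∀ x, q (e x) = 0 := fun x ↦ by simp [hex, hsx]
  have heK : ∀ x, e x ∈ KF := fun x ↦ by
    rw [← KF.ker_mkQ, LinearMap.mem_ker, ← hqx, hqe, map_zero]
  have hq_inj : Function.Injective q := by
    refine (injective_iff_map_eq_zero q).2 fun x hx ↦ ?_
    exact eq_zero_of_fixed e (fun i j ↦ hK (coord_mem_of_mem_smul_top (heK _) j))
      (by simp [hex, hx])
  have hmap : (LinearMap.ker t).map q = ⊤ := by
    refine hp.superfluous _ (top_le_iff.1 ?_)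
    rw [← LinearMap.range_eq_top.2 hq_surj, ← Submodule.map_top, ← hsup, Submodule.map_sup]
    refine sup_le_sup le_rfl (Submodule.map_le_iff_le_comap.2 fun x hx ↦ ?_)
    rw [Submodule.mem_comap, LinearMap.mem_ker, hqx, ← LinearMap.mem_ker, KF.ker_mkQ]
    exact hx
  have hker : LinearMap.ker t = ⊤ := by
    rw [← Submodule.comap_map_eq_of_injective hq_inj (LinearMap.ker t), hmap, Submodule.comap_top]
  refine ⟨fun a b ↦ ?_⟩
  obtain ⟨a, rfl⟩ := ht a
  obtain ⟨b, rfl⟩ := ht b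
  rw [LinearMap.ker_eq_top.1 hker]
  simp

end Nakayama

section SplitQuotient

/-- Projective modules lift semilinear maps through semilinear surjections. -/
lemma exists_linear_lift {R S P M N : Type u} [Ring R] [Ring S] [AddCommGroup P] [Module R P]
    [AddCommGroup M] [Module R M] [AddCommGroup N] [Module S N] [Module.Projective R P]
    {φ : R →+* S} (v : P →ₛₗ[φ] N) (η : M →ₛₗ[φ] N) (hη : Function.Surjective η) :
    ∃ f : P →ₗ[R] M, ∀ x, η (f x) = v x := by
  let : Module R N := Module.compHom N φ
  let v' : P →ₗ[R] N := { v with map_smul' := fun r x ↦ v.map_smulₛₗ r x }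
  let η' : M →ₗ[R] N := { η with map_smul' := fun r x ↦ η.map_smulₛₗ r x }
  obtain ⟨f, hf⟩ := Module.projective_lifting_property η' v' hη
  exact ⟨f, fun x ↦ LinearMap.congr_fun hf x⟩

variable {R : Type u} [Ring R] {K : Ideal R} [K.IsTwoSided] {big : Prop}

/-- If `Ind π C = C / K C` vanishes, then so does `C`. -/
lemma subsingleton_of_subsingleton_ind (hK : HasNakayama big K) {C : Type u} [AddCommGroup C]
    [Module R C] (hC : Admissible big R C) (h : ∀ c : C, Ind.unit (Ideal.Quotient.mk K) C c = 0) :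
    Subsingleton C := by
  refine hK (ModuleCat.of R C) hC (eq_top_iff.2 fun c _ ↦ ?_)
  let W : Submodule R C := K • ⊤
  let : Module (R ⧸ K) (C ⧸ W) := Module.IsTorsionBySet.module (I := K) <| by
    rintro x ⟨a, ha⟩
    obtain ⟨x, rfl⟩ := W.mkQ_surjective x
    rw [← map_smul]
    exact (Submodule.Quotient.mk_eq_zero W).2 (Submodule.smul_mem_smul ha trivial)
  let m : C →ₛₗ[Ideal.Quotient.mk K] (C ⧸ W) :=
    { W.mkQ with map_smul' := fun r x ↦ W.mkQ.map_smul r x }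
  have : m c = 0 := by
    rw [← Ind.lift_unit (φ := Ideal.Quotient.mk K) (ψ := RingHom.id (R ⧸ K)) m c, h, map_zero]
  exact (Submodule.Quotient.mk_eq_zero W).1 this

lemma unit_mk_surjective {M : Type u} [AddCommGroup M] [Module R M] :
    Function.Surjective (Ind.unit (Ideal.Quotient.mk K) M) := by
  intro x
  induction x using Ind.induction_on with
  | zero => exact ⟨0, map_zero _⟩
  | smul_unit s m =>
    obtain ⟨r, rfl⟩ := Ideal.Quotient.mk_surjective s
    exact ⟨r • m, LinearMap.map_smulₛₗ _ _ _⟩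
  | add x y hx hy =>
    obtain ⟨m, rfl⟩ := hx
    obtain ⟨n, rfl⟩ := hy
    exact ⟨m + n, map_add _ _ _⟩

variable {s : R ⧸ K →+* R}

/-- Projectivity is detected by extension of scalars along the section, as the retraction back
onto the quotient recovers the module. -/
lemma reflectsProjective_section (hs : (Ideal.Quotient.mk K).comp s = RingHom.id (R ⧸ K)) :
    ReflectsProjective big s := by
  intro N _ _ hN
  have : RingHomCompTriple s (Ideal.Quotient.mk K) (RingHom.id (R ⧸ K)) := ⟨hs⟩
  exact projective_of_semilinear_retract hs
    (Ind.lift s (Ideal.Quotient.mk K) (LinearMap.id (R := R ⧸ K) (M := N))) (Ind.unit s N)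
    (fun x ↦ by simp)

/-- Projectivity of an acyclic module `M` is detected by `N = M / K M`: the map from the projective
module `Ind s N` to `M` lifting `N = N` becomes bijective modulo `K`, so that its cokernel and, by
acyclicity, its kernel vanish modulo `K`. -/
lemma reflectsProjective_mk (hs : (Ideal.Quotient.mk K).comp s = RingHom.id (R ⧸ K))
    (hR : big ∨ IsNoetherianRing R) (hK : HasNakayama big K) :
    ReflectsProjective big (Ideal.Quotient.mk K) := by
  intro M hM htor hN
  let π := Ideal.Quotient.mk K
  let N := Ind π M
  have hcomp : RingHomCompTriple s π (RingHom.id (R ⧸ K)) := ⟨hs⟩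
  let v : Ind s N →ₛₗ[π] N := Ind.lift s π (LinearMap.id (R := R ⧸ K) (M := N))
  have hv : ∀ n, v (Ind.unit s N n) = n := fun n ↦ Ind.lift_unit _ n
  obtain ⟨f, hf⟩ := exists_linear_lift v (Ind.unit π M) unit_mk_surjective
  have hadm : Admissible big R (Ind s N) := hM.ind.ind
  have hf_surj : Function.Surjective f := by
    let W := LinearMap.range f
    have : Subsingleton (M ⧸ W) := by
      refine subsingleton_of_subsingleton_ind hK (hM.of_surjective W.mkQ W.mkQ_surjective) ?_
      intro c
      obtain ⟨m, rfl⟩ := W.mkQ_surjective c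
      have hm : Ind.unit π M (f (Ind.unit s N (Ind.unit π M m))) = Ind.unit π M m := by
        rw [hf, hv]
      have hz : W.mkQ (f (Ind.unit s N (Ind.unit π M m))) = 0 :=
        (Submodule.Quotient.mk_eq_zero W).2 ⟨_, rfl⟩
      change Ind.unit π (M ⧸ W) (W.mkQ m) = 0
      rw [← Ind.map_unit, ← hm, Ind.map_unit, hz, map_zero]
    exact LinearMap.range_eq_top.1 (Submodule.Quotient.subsingleton_iff.1 this)
  -- `w` is inverse to `Ind f`
  let w : N →ₗ[R ⧸ K] Ind π (Ind s N) := (Ind.unit π (Ind s N)).comp (Ind.unit s N)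
  have hw : ∀ n, Ind.map π f (w n) = n := fun n ↦ by
    change Ind.map π f (Ind.unit π _ (Ind.unit s N n)) = n
    rw [Ind.map_unit, hf, hv]
  have hw_surj : ∀ x, w (v x) = Ind.unit π (Ind s N) x := by
    intro x
    exact Ind.hom_ext (f := w.comp v) (g := Ind.unit π (Ind s N))
      (fun n ↦ by simp only [LinearMap.comp_apply]; exact congrArg w (hv n)) x
  have hinj : Function.Injective (Ind.map π f) := by
    have hsurj : Function.Surjective w := fun y ↦ by
      obtain ⟨x, rfl⟩ := unit_mk_surjective y
      exact ⟨_, hw_surj x⟩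
    refine (injective_iff_map_eq_zero _).2 fun y hy ↦ ?_
    obtain ⟨n, rfl⟩ := hsurj y
    rw [hw] at hy
    rw [hy, map_zero]
  have hf_inj : Function.Injective f := by
    have hkermap := Ind.map_injective (φ := π) (LinearMap.ker f).injective_subtype
      f.exact_subtype_ker_map hf_surj htor
    have : Subsingleton (LinearMap.ker f) := by
      refine subsingleton_of_subsingleton_ind hK (hadm.submodule hR _) fun c ↦ ?_
      refine hkermap (hinj ?_)
      rw [map_zero, map_zero]
      exact (Ind.map_exact f.exact_subtype_ker_map hf_surj).apply_apply_eq_zero _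
    exact LinearMap.ker_eq_bot.1 ((Submodule.subsingleton_iff_eq_bot).1 this)
  exact Module.Projective.of_equiv (LinearEquiv.ofBijective f ⟨hf_inj, hf_surj⟩)

end SplitQuotient

/-! ### Restriction of scalars, global dimension and the quotient as a right module -/

section Restriction

variable {R S : Type u} [Ring R] [Ring S] {φ : R →+* S} {N N' : Type u} [AddCommGroup N]
  [Module S N] [AddCommGroup N'] [Module S N']

/-- The restriction of scalars of a left `S`-module along `φ : R → S`. -/
def Restriction (_ : R →+* S) (N : Type u) : Type u := N

namespace Restriction

instance : AddCommGroup (Restriction φ N) := inferInstanceAs (AddCommGroup N)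

instance : Module R (Restriction φ N) := Module.compHom N φ

/-- The identity, as a semilinear map from the restriction of scalars. -/
def down : Restriction φ N →ₛₗ[φ] N where
  toFun x := x
  map_add' _ _ := rfl
  map_smul' _ _ := rfl

/-- A section of `φ` makes the identity a semilinear map into the restriction of scalars. -/
def up {s : S →+* R} (hs : φ.comp s = RingHom.id S) : N →ₛₗ[s] Restriction φ N where
  toFun x := x
  map_add' _ _ := rfl
  map_smul' a x := show a • x = φ (s a) • x by
    rw [show φ (s a) = a from RingHom.congr_fun hs a]

variable (φ) in
/-- Functoriality of the restriction of scalars. -/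
def map (f : N →ₗ[S] N') : Restriction φ N →ₗ[R] Restriction φ N' where
  toFun x := f x
  map_add' x y := f.map_add x y
  map_smul' r x := f.map_smul (φ r) x

lemma finite (hφ : Function.Surjective φ) [Module.Finite S N] :
    Module.Finite R (Restriction φ N) := by
  obtain ⟨s, hs⟩ := Module.Finite.fg_top (R := S) (M := N)
  have key : ∀ x : N, x ∈ Submodule.span S (s : Set N) →
      (show Restriction φ N from x) ∈
        Submodule.span R (show Set (Restriction φ N) from (s : Set N)) := by
    intro x hx
    induction hx using Submodule.span_induction with
    | mem x hx => exact Submodule.subset_span hx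
    | zero => exact zero_mem _
    | add x y _ _ hx hy => exact add_mem hx hy
    | smul a x _ hx =>
      obtain ⟨r, rfl⟩ := hφ a
      exact Submodule.smul_mem _ r hx
  exact ⟨⟨s, eq_top_iff.2 fun x _ ↦ key x (hs ▸ Submodule.mem_top)⟩⟩

/-- A projective `S`-module `N` is a direct summand of `S^(N)`. -/
lemma pd_le_of_projective [Module.Projective S N] {e : ℕ} (he : pd R (Restriction φ S) ≤ e) :
    pd R (Restriction φ N) ≤ e := by
  obtain ⟨i, hi⟩ := Module.projective_def'.1 ‹Module.Projective S N›
  let j : Restriction φ (N →₀ S) →ₗ[R] (N →₀ Restriction φ S) :=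
    { toFun := fun x ↦ x
      map_add' := fun _ _ ↦ rfl
      map_smul' := fun _ _ ↦ rfl }
  let j' : (N →₀ Restriction φ S) →ₗ[R] Restriction φ (N →₀ S) :=
    { toFun := fun x ↦ x
      map_add' := fun _ _ ↦ rfl
      map_smul' := fun _ _ ↦ rfl }
  exact (pd_le_of_retract (j.comp (map φ i))
    ((map φ (Finsupp.linearCombination S id)).comp j')
    (fun x ↦ LinearMap.congr_fun hi x)).trans (pd_finsupp_le N he)

lemma pd_le {e n : ℕ} (he : pd R (Restriction φ S) ≤ e) (hN : pd S N ≤ n) :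
    pd R (Restriction φ N) ≤ (e + n : ℕ) := by
  induction n generalizing N with
  | zero =>
    rw [Nat.cast_zero, pd_le_zero_iff] at hN
    exact pd_le_of_projective he
  | succ n ih =>
    obtain ⟨P, g, hP, hg⟩ := exists_projective_surjective S N
    rw [pd_le_succ_iff_ker hg] at hN
    exact pd_le_right (f := map φ (LinearMap.ker g).subtype) (g := map φ g)
      (LinearMap.ker g).injective_subtype g.exact_subtype_ker_map hg (ih hN)
      ((pd_le_of_projective he).trans (Nat.cast_le.2 (by lia)))

end Restriction

end Restriction

section GlobalDimension

open Abelian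

variable {R : Type u} [Ring R]

lemma hasInjectiveDimensionLE_of_ext_ideal {n : ℕ} (Y : ModuleCat.{u} R)
    (h : ∀ I : Ideal R, Subsingleton (Ext.{u} (ModuleCat.of R (R ⧸ I)) Y (n + 1))) :
    HasInjectiveDimensionLE Y n := by
  induction n generalizing Y with
  | zero =>
    refine injective_iff_hasInjectiveDimensionLT_one.1 ?_
    have : Module.Injective R Y := by
      refine Module.Baer.injective fun I g ↦ ?_
      obtain ⟨g', hg'⟩ := exists_extension_of_subsingleton_ext (f := I.subtype) (g := I.mkQ)
        I.injective_subtype (LinearMap.exact_subtype_mkQ I) I.mkQ_surjective (h I) g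
      exact ⟨g', fun x hx ↦ hg' ⟨x, hx⟩⟩
    exact Module.injective_object_of_injective_module R Y
  | succ n ih =>
    obtain ⟨⟨E, hE, i, hi⟩⟩ := EnoughInjectives.presentation Y
    have hi' : Function.Injective i.hom := (ModuleCat.mono_iff_injective i).1 hi
    have hS := shortExact_of_exact hi' (LinearMap.exact_map_mkQ_range i.hom)
      (Submodule.mkQ_surjective _)
    refine (hS.hasInjectiveDimensionLT_X₃_iff n hE).1 (ih _ fun I ↦ ?_)
    refine subsingleton_of_forall_eq 0 fun x ↦ ?_
    obtain ⟨y, rfl⟩ := Ext.covariant_sequence_exact₃ _ hS x rfl (Subsingleton.elim (h := h I) _ _)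
    have : Injective (shortComplexOfExact (LinearMap.exact_map_mkQ_range i.hom)).X₂ := hE
    rw [y.eq_zero_of_injective, Ext.zero_comp]

/-- Auslander's theorem: the global dimension is determined by the cyclic modules. By Baer's
criterion, the vanishing of `Ext^{n+1}(R / I, -)` bounds all injective dimensions by `n`. -/
lemma pd_le_of_forall_ideal {n : ℕ} (h : ∀ I : Ideal R, pd R (R ⧸ I) ≤ n) (M : Type u)
    [AddCommGroup M] [Module R M] : pd R M ≤ n := by
  rw [pd_le_iff]
  refine hasProjectiveDimensionLT_of_enoughInjectives.{u} _ _ fun Y ↦ ?_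
  have := hasInjectiveDimensionLE_of_ext_ideal (n := n) Y fun I ↦
    have := pd_le_iff.1 (h I)
    HasProjectiveDimensionLT.subsingleton.{u} (ModuleCat.of R (R ⧸ I)) (n + 1) _ le_rfl Y
  exact HasInjectiveDimensionLT.subsingleton.{u} Y (n + 1) _ le_rfl _

end GlobalDimension

section SplitQuotient

variable {R : Type u} [Ring R] {K : Ideal R} [K.IsTwoSided]

instance projective_rightRestriction_id :
    Module.Projective Rᵐᵒᵖ (RightRestriction (RingHom.id R)) :=
  let e : Rᵐᵒᵖ ≃ₗ[Rᵐᵒᵖ] RightRestriction (RingHom.id R) :=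
    { toFun := fun r ↦ RightRestriction.of (RingHom.id R) r.unop
      invFun := fun r ↦ op ((RightRestriction.of (RingHom.id R)).symm r)
      left_inv := fun _ ↦ rfl
      right_inv := fun _ ↦ rfl
      map_add' := fun _ _ ↦ rfl
      map_smul' := fun _ _ ↦ rfl }
  .of_equiv e

lemma pd_rightRestriction_mk_le {d : ℕ} (h : pd Rᵐᵒᵖ (rightModule K) ≤ d) :
    pd Rᵐᵒᵖ (RightRestriction (Ideal.Quotient.mk K)) ≤ (d + 1 : ℕ) := by
  let f : rightModule K →ₗ[Rᵐᵒᵖ] RightRestriction (RingHom.id R) :=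
    { toFun := fun x ↦ RightRestriction.of (RingHom.id R) x
      map_add' := fun _ _ ↦ rfl
      map_smul' := fun _ _ ↦ rfl }
  let g : RightRestriction (RingHom.id R) →ₗ[Rᵐᵒᵖ] RightRestriction (Ideal.Quotient.mk K) :=
    { toFun := fun x ↦ RightRestriction.of (Ideal.Quotient.mk K)
        (Ideal.Quotient.mk K ((RightRestriction.of (RingHom.id R)).symm x))
      map_add' := fun x y ↦ map_add (Ideal.Quotient.mk K) (show R from x) (show R from y)
      map_smul' := fun r x ↦ map_mul (Ideal.Quotient.mk K) (show R from x) r.unop }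
  refine (pd_le_succ_iff (f := f) (g := g) Subtype.val_injective (fun x ↦ ?_)
    (Ideal.Quotient.mk_surjective (I := K))).2 h
  exact (Ideal.Quotient.eq_zero_iff_mem (I := K) (a := (show R from x))).trans
    ⟨fun hx ↦ ⟨⟨x, hx⟩, rfl⟩, by rintro ⟨y, rfl⟩; exact y.2⟩

/-- If `K * K = 0`, then `R = (R / K) ⊕ K` as a right module over `R / K`, and `K` is as a module
over `R / K` a retract of `K` as a module over `R`. -/
lemma pd_rightRestriction_section_le {s : R ⧸ K →+* R}
    (hs : (Ideal.Quotient.mk K).comp s = RingHom.id (R ⧸ K)) (hK : K * K = ⊥) {d : ℕ}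
    (h : pd Rᵐᵒᵖ (rightModule K) ≤ d) : pd (R ⧸ K)ᵐᵒᵖ (RightRestriction s) ≤ d := by
  let g : RightRestriction s →ₗ[(R ⧸ K)ᵐᵒᵖ] RightRestriction (RingHom.id (R ⧸ K)) :=
    { toFun := fun x ↦ RightRestriction.of (RingHom.id (R ⧸ K))
        (Ideal.Quotient.mk K ((RightRestriction.of s).symm x))
      map_add' := fun x y ↦ map_add (Ideal.Quotient.mk K) (show R from x) (show R from y)
      map_smul' := fun r x ↦ (map_mul (Ideal.Quotient.mk K) (show R from x) (s r.unop)).trans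
        (congrArg (Ideal.Quotient.mk K (show R from x) * ·) (RingHom.congr_fun hs r.unop)) }
  have hmem : ∀ x : RightRestriction s, x ∈ LinearMap.ker g ↔ (show R from x) ∈ K := fun x ↦
    Ideal.Quotient.eq_zero_iff_mem (I := K) (a := (show R from x))
  have hmul : ∀ x ∈ K, ∀ r : R, x * s (Ideal.Quotient.mk K r) = x * r := by
    intro x hx r
    have h1 : s (Ideal.Quotient.mk K r) - r ∈ K := by
      rw [← Ideal.Quotient.eq_zero_iff_mem, map_sub, sub_eq_zero]
      exact RingHom.congr_fun hs (Ideal.Quotient.mk K r)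
    rw [← sub_eq_zero, ← mul_sub]
    exact (Submodule.mem_bot R).1 (hK ▸ Ideal.mul_mem_mul hx h1)
  have hop : (RingHom.op (Ideal.Quotient.mk K)).comp (RingHom.op s) =
      RingHom.id (R ⧸ K)ᵐᵒᵖ := RingHom.ext fun x ↦ congrArg op (RingHom.congr_fun hs x.unop)
  have hker : pd (R ⧸ K)ᵐᵒᵖ (LinearMap.ker g) ≤ d := by
    refine (pd_le_of_semilinear_retract hop (M := rightModule K)
      { toFun := fun x ↦ ⟨RightRestriction.of s x, (hmem _).2 x.2⟩
        map_add' := fun _ _ ↦ rfl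
        map_smul' := fun r x ↦ Subtype.ext (hmul x x.2 r.unop).symm }
      { toFun := fun x ↦ ⟨(RightRestriction.of s).symm x, (hmem _).1 x.2⟩
        map_add' := fun _ _ ↦ rfl
        map_smul' := fun _ _ ↦ rfl } (fun _ ↦ rfl)).trans h
  refine pd_le_middle (LinearMap.ker g).injective_subtype g.exact_subtype_ker_map
    (Ideal.Quotient.mk_surjective (I := K)) hker ?_
  exact (pd_le_zero_iff.2 inferInstance).trans bot_le

lemma pd_restriction_mk_lt_top (h : pd R K < ⊤) :
    pd R (Restriction (Ideal.Quotient.mk K) (R ⧸ K)) < ⊤ := by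
  obtain ⟨n, hn⟩ := pd_lt_top_iff.1 h
  let g : R →ₗ[R] Restriction (Ideal.Quotient.mk K) (R ⧸ K) :=
    { toFun := Ideal.Quotient.mk K
      map_add' := map_add _
      map_smul' := map_mul (Ideal.Quotient.mk K) }
  have hg : Function.Surjective g := Ideal.Quotient.mk_surjective (I := K)
  refine pd_lt_top_iff.2 ⟨n + 1, (pd_le_succ_iff (f := Submodule.subtype K) (g := g)
    Subtype.val_injective (fun x ↦ ?_) hg).2 hn⟩
  exact (Ideal.Quotient.eq_zero_iff_mem (I := K) (a := x)).trans
    ⟨fun hx ↦ ⟨⟨x, hx⟩, rfl⟩, by rintro ⟨y, rfl⟩; exact y.2⟩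

lemma pd_le_pd_restriction {s : R ⧸ K →+* R}
    (hs : (Ideal.Quotient.mk K).comp s = RingHom.id (R ⧸ K)) {N : Type u} [AddCommGroup N]
    [Module (R ⧸ K) N] : pd (R ⧸ K) N ≤ pd R (Restriction (Ideal.Quotient.mk K) N) :=
  pd_le_of_semilinear_retract hs Restriction.down (Restriction.up hs) fun _ ↦ rfl

end SplitQuotient

/-! ### Comparison of the finitistic dimensions -/

section FinitisticDimension

/-- The finitistic dimension formed with all modules (if `big` holds) or with the finitely
generated ones (otherwise). -/
noncomputable def finDim (big : Prop) (R : Type u) [Ring R] : ℕ∞ :=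
  ⨆ (M : ModuleCat.{u} R) (_ : Admissible big R M) (_ : pd R M < ⊤), pd R M

variable {R : Type u} [Ring R] {big : Prop}

lemma finDim_false : finDim False R = littleFinDim R := by
  simp only [finDim, littleFinDim, Admissible, false_or]

lemma finDim_true : finDim True R = bigFinDim R := by
  simp only [finDim, bigFinDim, Admissible, true_or, iSup_pos]

lemma le_finDim (M : ModuleCat.{u} R) (h : Admissible big R M) (hM : pd R M < ⊤) :
    pd R M ≤ finDim big R :=
  le_iSup_of_le M (le_iSup_of_le h (le_iSup_of_le hM le_rfl))

lemma le_globalDim (M : ModuleCat.{u} R) : pd R M ≤ globalDim R :=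
  le_iSup (fun M : ModuleCat.{u} R ↦ pd R M) M

variable {K : Ideal R} [K.IsTwoSided] {s : R ⧸ K →+* R}

lemma exists_pd_le_quotient (hs : (Ideal.Quotient.mk K).comp s = RingHom.id (R ⧸ K))
    (hR : big ∨ IsNoetherianRing R) (hK : HasNakayama big K) {d : ℕ}
    (hd : pd Rᵐᵒᵖ (rightModule K) ≤ d) (M : ModuleCat.{u} R) (hM : Admissible big R M) :
    ∃ N : ModuleCat.{u} (R ⧸ K), Admissible big (R ⧸ K) N ∧ (pd R M < ⊤ → pd (R ⧸ K) N < ⊤) ∧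
      pd R M ≤ pd (R ⧸ K) N + (d + 1 : ℕ) :=
  (reflectsProjective_mk hs hR hK).exists_pd_le hR (pd_rightRestriction_mk_le hd) hM

lemma finDim_le_quotient (hs : (Ideal.Quotient.mk K).comp s = RingHom.id (R ⧸ K))
    (hR : big ∨ IsNoetherianRing R) (hK : HasNakayama big K) :
    finDim big R ≤ finDim big (R ⧸ K) + pd Rᵐᵒᵖ (rightModule K) + 1 := by
  generalize hd : pd Rᵐᵒᵖ (rightModule K) = d
  induction d with
  | top => simp
  | coe d =>
    refine iSup_le fun M ↦ iSup_le fun hM ↦ iSup_le fun hfin ↦ ?_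
    obtain ⟨N, hN, hNfin, hle⟩ := exists_pd_le_quotient hs hR hK hd.le M hM
    refine hle.trans ?_
    rw [add_assoc]
    push_cast
    gcongr
    exact le_finDim N hN (hNfin hfin)

lemma globalDim_le_quotient (hs : (Ideal.Quotient.mk K).comp s = RingHom.id (R ⧸ K))
    (hR : big ∨ IsNoetherianRing R) (hK : HasNakayama big K) :
    globalDim R ≤ globalDim (R ⧸ K) + pd Rᵐᵒᵖ (rightModule K) + 1 := by
  generalize hd : pd Rᵐᵒᵖ (rightModule K) = d
  induction d with
  | top => simp
  | coe d =>
    have key : ∀ M : ModuleCat.{u} R, Admissible big R M →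
        pd R M ≤ globalDim (R ⧸ K) + d + 1 := by
      intro M hM
      obtain ⟨N, -, -, hle⟩ := exists_pd_le_quotient hs hR hK hd.le M hM
      refine hle.trans ?_
      rw [add_assoc]
      push_cast
      gcongr
      exact le_globalDim N
    refine iSup_le fun M ↦ pd_le_of_forall fun n hn ↦ pd_le_of_forall_ideal (fun I ↦ ?_) M
    exact (key (ModuleCat.of R (R ⧸ I)) (Or.inr inferInstance)).trans hn

lemma globalDim_quotient_le (hs : (Ideal.Quotient.mk K).comp s = RingHom.id (R ⧸ K)) :
    globalDim (R ⧸ K) ≤ globalDim R :=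
  iSup_le fun N ↦ (pd_le_pd_restriction hs).trans
    (le_globalDim (ModuleCat.of R (Restriction (Ideal.Quotient.mk K) N)))

lemma finDim_quotient_le (hs : (Ideal.Quotient.mk K).comp s = RingHom.id (R ⧸ K))
    (hK : pd R K < ⊤) : finDim big (R ⧸ K) ≤ finDim big R := by
  refine iSup_le fun N ↦ iSup_le fun hN ↦ iSup_le fun hfin ↦ (pd_le_pd_restriction hs).trans ?_
  obtain ⟨e, he⟩ := pd_lt_top_iff.1 (pd_restriction_mk_lt_top hK)
  obtain ⟨n, hn⟩ := pd_lt_top_iff.1 hfin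
  have hadm : Admissible big R (Restriction (Ideal.Quotient.mk K) N) :=
    hN.imp_right fun (_ : Module.Finite (R ⧸ K) N) ↦
      Restriction.finite Ideal.Quotient.mk_surjective
  exact le_finDim (ModuleCat.of R (Restriction (Ideal.Quotient.mk K) N)) hadm
    (pd_lt_top_iff.2 ⟨_, Restriction.pd_le (N := N) he hn⟩)

lemma finDim_quotient_le_add (hs : (Ideal.Quotient.mk K).comp s = RingHom.id (R ⧸ K))
    (hR : big ∨ IsNoetherianRing R) (hK : K * K = ⊥) :
    finDim big (R ⧸ K) ≤ finDim big R + pd Rᵐᵒᵖ (rightModule K) := by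
  generalize hd : pd Rᵐᵒᵖ (rightModule K) = d
  induction d with
  | top => simp
  | coe d =>
    refine iSup_le fun N ↦ iSup_le fun hN ↦ iSup_le fun hfin ↦ ?_
    have hR' : big ∨ IsNoetherianRing (R ⧸ K) := hR.imp_right fun (_ : IsNoetherianRing R) ↦
      isNoetherianRing_of_surjective R (R ⧸ K) (Ideal.Quotient.mk K) Ideal.Quotient.mk_surjective
    obtain ⟨M, hM, hMfin, hle⟩ := (reflectsProjective_section hs).exists_pd_le hR'
      (pd_rightRestriction_section_le hs hK hd.le) hN
    refine hle.trans ?_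
    gcongr
    exact le_finDim M hM (hMfin hfin)

end FinitisticDimension

end FinitisticDim

open FinitisticDim in
theorem theoremA {Λ : Type u} [Ring Λ] (K : Ideal Λ) [K.IsTwoSided]
    (hKJ : K ≤ Ring.jacobson Λ) (hsplit : SplitQuotient K) :
    -- the equivalences over a left artinian ring
    (IsArtinianRing Λ → pd Λᵐᵒᵖ (rightModule K) < ⊤ → (pd Λ K < ⊤ ∨ K * K = ⊥) →
      (littleFinDim Λ < ⊤ ↔ littleFinDim (Λ ⧸ K) < ⊤) ∧
      (bigFinDim Λ < ⊤ ↔ bigFinDim (Λ ⧸ K) < ⊤) ∧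
      (globalDim Λ < ⊤ ↔ globalDim (Λ ⧸ K) < ⊤)) ∧
    -- the inequalities for the little finitistic dimension
    (IsNoetherianRing Λ → IsSemiperfect Λ →
      (pd Λ K < ⊤ →
        littleFinDim (Λ ⧸ K) ≤ littleFinDim Λ ∧
        littleFinDim Λ ≤ littleFinDim (Λ ⧸ K) + pd Λᵐᵒᵖ (rightModule K) + 1) ∧
      (K * K = ⊥ →
        littleFinDim (Λ ⧸ K) ≤ littleFinDim Λ + pd Λᵐᵒᵖ (rightModule K) ∧
        littleFinDim Λ ≤ littleFinDim (Λ ⧸ K) + pd Λᵐᵒᵖ (rightModule K) + 1)) ∧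
    -- the inequalities for the big finitistic dimension
    (IsLeftPerfect Λ →
      (pd Λ K < ⊤ →
        bigFinDim (Λ ⧸ K) ≤ bigFinDim Λ ∧
        bigFinDim Λ ≤ bigFinDim (Λ ⧸ K) + pd Λᵐᵒᵖ (rightModule K) + 1) ∧
      (K * K = ⊥ →
        bigFinDim (Λ ⧸ K) ≤ bigFinDim Λ + pd Λᵐᵒᵖ (rightModule K) ∧
        bigFinDim Λ ≤ bigFinDim (Λ ⧸ K) + pd Λᵐᵒᵖ (rightModule K) + 1)) ∧
    -- the inequalities for the global dimension
    ((IsNoetherianRing Λ ∧ IsSemiperfect Λ) ∨ IsLeftPerfect Λ →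
      (pd Λ K < ⊤ →
        globalDim (Λ ⧸ K) ≤ globalDim Λ ∧
        globalDim Λ ≤ globalDim (Λ ⧸ K) + pd Λᵐᵒᵖ (rightModule K) + 1) ∧
      (K * K = ⊥ →
        globalDim (Λ ⧸ K) ≤ globalDim Λ + pd Λᵐᵒᵖ (rightModule K) ∧
        globalDim Λ ≤ globalDim (Λ ⧸ K) + pd Λᵐᵒᵖ (rightModule K) + 1)) := by
  obtain ⟨s, hs⟩ := hsplit
  have little (hΛ : IsNoetherianRing Λ) :
      (pd Λ K < ⊤ → littleFinDim (Λ ⧸ K) ≤ littleFinDim Λ) ∧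
      (K * K = ⊥ → littleFinDim (Λ ⧸ K) ≤ littleFinDim Λ + pd Λᵐᵒᵖ (rightModule K)) ∧
      littleFinDim Λ ≤ littleFinDim (Λ ⧸ K) + pd Λᵐᵒᵖ (rightModule K) + 1 := by
    simp only [← finDim_false]
    exact ⟨finDim_quotient_le hs, finDim_quotient_le_add hs (Or.inr hΛ),
      finDim_le_quotient hs (Or.inr hΛ) (hasNakayama_finite hKJ)⟩
  have large (hN : HasNakayama True K) :
      (pd Λ K < ⊤ → bigFinDim (Λ ⧸ K) ≤ bigFinDim Λ) ∧
      (K * K = ⊥ → bigFinDim (Λ ⧸ K) ≤ bigFinDim Λ + pd Λᵐᵒᵖ (rightModule K)) ∧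
      bigFinDim Λ ≤ bigFinDim (Λ ⧸ K) + pd Λᵐᵒᵖ (rightModule K) + 1 := by
    simp only [← finDim_true]
    exact ⟨finDim_quotient_le hs, finDim_quotient_le_add hs (Or.inl trivial),
      finDim_le_quotient hs (Or.inl trivial) hN⟩
  have finite_of_le {x y : ℕ∞} (hd : pd Λᵐᵒᵖ (rightModule K) < ⊤) (hx : x < ⊤)
      (h : y ≤ x + pd Λᵐᵒᵖ (rightModule K) + 1) : y < ⊤ :=
    h.trans_lt (ENat.add_lt_top.2 ⟨ENat.add_lt_top.2 ⟨hx, hd⟩, ENat.natCast_lt_top 1⟩)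
  have gd_lower := globalDim_quotient_le hs
  refine ⟨fun hΛ hd hK ↦ ?_, fun hΛ _ ↦ ?_, fun hΛ ↦ ?_, fun hΛ ↦ ?_⟩
  · obtain ⟨l₁, l₂, l₃⟩ := little inferInstance
    obtain ⟨b₁, b₂, b₃⟩ := large (hasNakayama_of_isArtinianRing hKJ)
    refine ⟨⟨fun h ↦ ?_, fun h ↦ finite_of_le hd h l₃⟩,
      ⟨fun h ↦ ?_, fun h ↦ finite_of_le hd h b₃⟩,
      ⟨gd_lower.trans_lt, fun h ↦ finite_of_le hd h (globalDim_le_quotient hs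
        (Or.inl trivial) (hasNakayama_of_isArtinianRing hKJ))⟩⟩
    · exact hK.elim (fun hK ↦ (l₁ hK).trans_lt h)
        fun hK ↦ finite_of_le hd h ((l₂ hK).trans le_self_add)
    · exact hK.elim (fun hK ↦ (b₁ hK).trans_lt h)
        fun hK ↦ finite_of_le hd h ((b₂ hK).trans le_self_add)
  · obtain ⟨l₁, l₂, l₃⟩ := little hΛ
    exact ⟨fun h ↦ ⟨l₁ h, l₃⟩, fun h ↦ ⟨l₂ h, l₃⟩⟩
  · obtain ⟨b₁, b₂, b₃⟩ := large (hasNakayama_of_isLeftPerfect hΛ hKJ)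
    exact ⟨fun h ↦ ⟨b₁ h, b₃⟩, fun h ↦ ⟨b₂ h, b₃⟩⟩
  · have upper : globalDim Λ ≤ globalDim (Λ ⧸ K) + pd Λᵐᵒᵖ (rightModule K) + 1 := by
      rcases hΛ with ⟨hΛ, -⟩ | hΛ
      · exact globalDim_le_quotient hs (Or.inr hΛ) (hasNakayama_finite hKJ)
      · exact globalDim_le_quotient hs (Or.inl trivial) (hasNakayama_of_isLeftPerfect hΛ hKJ)
    exact ⟨fun _ ↦ ⟨gd_lower, upper⟩, fun _ ↦ ⟨gd_lower.trans le_self_add, upper⟩⟩
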